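/- **Setting.** A parameter is a triple $\theta=(\pi_0,F_0,F_1)$ with $\pi_0\in[0,1]$ and $F_0,F_1$ continuous distribution functions of probability laws on $[0,1]$; put $F=\pi_0F_0+(1-\pi_0)F_1$. Under $\mathbb P_\theta$ (independent two-group model with $m$ hypotheses) the indicators $H_1,\dots,H_m$ are i.i.d. Bernoulli$(1-\pi_0)$ and, conditionally on them, the $p$-values $p_1,\dots,p_m$ are independent with $p_i\sim F_0$ if $H_i=0$ and $p_i\sim F_1$ if $H_i=1$. Let $\Theta$ be the set of $\theta$ such that $\pi_0\in(0,1]$, $F_0(x)\le x$ for all $x\in[0,1]$, and $F$ has a density that is Lipschitz on $[0,1]$. For $\theta\in\Theta$ let $$\pi_0^*(\theta)=\inf_{\lambda\in[0,1)}\frac{1-F(\lambda)}{1-\lambda}.$$ **Adaptive BH.** A $\pi_0$-estimator is, for each $m$, a measurable function $\hat\pi_0=\hat\pi_0(p_1,\dots,p_m)$ with values in $[0,\infty)$. With the order statistics $0=:p_{(0)}\le p_{(1)}\le\dots\le p_{(m)}$, the procedure $\mathrm{ABH}_\alpha(\hat\pi_0)$ rejects the nulls $i$ with $p_i\le\hat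 t$, where $\hat t=1\wedge(\alpha\hat k/(m\hat\pi_0))$ and $\hat k=\max\{k\in\{0,\dots,m\}:p_{(k)}\le 1\wedge(\alpha k/(m\hat\pi_0))\}$ (conventions $1/0=+\infty$, $0\cdot\infty=0$). Its false discovery rate and power are $$\mathrm{FDR}_\theta=\mathbb E_\theta\Big[\frac{\#\{i:H_i=0,\,p_i\le\hat t\}}{\hat k\vee1}\Big],\qquad \mathrm{Pow}_\theta=\mathbb E_\theta\Big[\frac{\#\{i:H_i=1,\,p_i\le\hat t\}}{m}\Big].$$ **Minimum-Storey (MS) estimator.** For $\epsilon,\underline\pi_0\in(0,1)$, $$\hat\pi^{\mathrm{MS}}_{0,\epsilon,\underline\pi_0}=\underline\pi_0\vee\Big(C(m,\epsilon,\underline\pi_0)\inf_{\lambda\in[0,1-\epsilon]}\frac{1\vee\sum_{i=1}^m\mathbf 1\{p_i\ge\lambda\}}{m(1-\lambda)}\Big),\qquad C(m,\epsilon,\underline\pi_0)=\max_{\underline\pi_0m\le s\le m}c(s,\epsilon),$$ $$c(s,\epsilon)=\mathbb E\Big[1\vee\max_{\lambda\in\{q_1,\dots,q_s\}\cap(0,1-\epsilon)}\frac{s(1-\lambda)}{1\vee\sum_{i=1}^s\mathbf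 1\{q_i>\lambda\}}\Big],$$ where $s$ ranges over integers, $q_1=0$ and $q_2,\dots,q_s$ are i.i.d. uniform on $(0,1)$ (an empty maximum is ignored). **Corollary.** Let $\tilde\pi_0$ be a $\pi_0$-estimator such that 1. (FDR-conservative over $\Theta$) $\mathrm{FDR}_\theta(\mathrm{ABH}_\alpha(\tilde\pi_0))\le\alpha$ for all $\alpha\in(0,1)$, $m\ge2$, $\theta\in\Theta$; 2. (concentrating over $\Theta$) there are $\bar\pi_0(\theta)>0$, not depending on $m$, and sequences $\eta_m(\theta)$, $\delta_m(\theta)$ tending to $0$ as $m\to\infty$ for each fixed $\theta\in\Theta$, such that for $m$ large enough, for all $\theta\in\Theta$, $\mathbb P_\theta(|\tilde\pi_0-\bar\pi_0(\theta)|\le\eta_m(\theta))\ge1-\delta_m(\theta)$. Take $\epsilon=m^{-1/4}$ and $\underline\pi_0=0.5\wedge(162/\log m)$. Then for every $\theta\in\Theta$ and for all $m$ large enough (depending on $\theta$), $$\sup_{\alpha\in(0,1]}\Big\{\mathrm{Pow}_\theta\big(\mathrm{ABH}_{\alpha'}(\tilde\pi_0)\big)-\mathrm{Pow}_\theta\big(\mathrm{ABH}_\alpha(\hat\pi^{\mathrm{MS}}_{0,\epsilon,\underline\pi_0})\big)\Big\}\le\frac1m+\delta_m(\theta),$$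 where $$\alpha'=\alpha\Big(1-\frac{4}{\pi_0^*(\theta)}\,\frac{\sqrt{\log m}}{m^{1/4}}\Big)\Big(1-\frac{\eta_m(\theta)}{\pi_0^*(\theta)-\eta_m(\theta)}\Big).$$ -/

import Mathlib

open MeasureTheory ProbabilityTheory Filter Topology

noncomputable section

namespace MultTest

/-- Parameter `θ = (π₀, F₀, F₁)` of the independent two-group model: a null proportion and two
distributions of `p`-values on `[0,1]` with continuous distribution functions. -/
structure TwoGroup where
  pi0 : ℝ
  pi0_mem : pi0 ∈ Set.Icc (0 : ℝ) 1
  nu0 : Measure ℝ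
  nu1 : Measure ℝ
  isProb0 : IsProbabilityMeasure nu0
  isProb1 : IsProbabilityMeasure nu1
  supp0 : nu0 (Set.Icc 0 1) = 1
  supp1 : nu1 (Set.Icc 0 1) = 1
  cont0 : Continuous (cdf nu0)
  cont1 : Continuous (cdf nu1)

attribute [instance] TwoGroup.isProb0 TwoGroup.isProb1

/-- The mixture distribution function `F = π₀ F₀ + (1 - π₀) F₁`. -/
def TwoGroup.F (θ : TwoGroup) (x : ℝ) : ℝ :=
  θ.pi0 * cdf θ.nu0 x + (1 - θ.pi0) * cdf θ.nu1 x

/-- Law of one pair `(Hᵢ, pᵢ)`: `Hᵢ` is Bernoulli with `P(Hᵢ = true) = 1 - π₀` (`true` means that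
the `i`-th null hypothesis is false); given `Hᵢ`, the `p`-value `pᵢ` has law `F₀` if `Hᵢ = false`
and `F₁` if `Hᵢ = true`. -/
def TwoGroup.pairLaw (θ : TwoGroup) : Measure (Bool × ℝ) :=
  ENNReal.ofReal θ.pi0 • (Measure.dirac false).prod θ.nu0
    + ENNReal.ofReal (1 - θ.pi0) • (Measure.dirac true).prod θ.nu1

instance (θ : TwoGroup) : IsProbabilityMeasure θ.pairLaw := by
  constructor
  have h0 := θ.pi0_mem.1
  have h1 := θ.pi0_mem.2
  simp only [TwoGroup.pairLaw, Measure.add_apply, Measure.smul_apply, measure_univ, smul_eq_mul,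
    mul_one]
  rw [← ENNReal.ofReal_add h0 (by linarith)]
  simp

/-- Law of `((H₁, p₁), …, (H_m, p_m))` in the independent two-group model. -/
def TwoGroup.law (θ : TwoGroup) (m : ℕ) : Measure (Fin m → Bool × ℝ) :=
  Measure.pi fun _ => θ.pairLaw

/-- The family of `p`-values. -/
def pvals {m : ℕ} (ω : Fin m → Bool × ℝ) : Fin m → ℝ := fun i => (ω i).2

/-- The parameter set: `π₀ ∈ (0,1]`, `F₀(x) ≤ x` on `[0,1]` (super-uniform null), and `F` has a
density that is Lipschitz on `[0,1]`. -/
def superUnifParams : Set TwoGroup :=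
  {θ | 0 < θ.pi0 ∧ (∀ x ∈ Set.Icc (0 : ℝ) 1, cdf θ.nu0 x ≤ x) ∧
    ∃ f : ℝ → ℝ, (∃ L, LipschitzOnWith L f (Set.Icc 0 1)) ∧
      (∀ x ∈ Set.Icc (0 : ℝ) 1, 0 ≤ f x) ∧
      ∀ x ∈ Set.Icc (0 : ℝ) 1, θ.F x = ∫ t in (0 : ℝ)..x, f t}

/-- `π₀*(θ) = inf_{x ∈ [0,1)} (1 - F(x)) / (1 - x)`. -/
def TwoGroup.pi0Star (θ : TwoGroup) : ℝ :=
  sInf ((fun x : ℝ => (1 - θ.F x) / (1 - x)) '' Set.Ico 0 1)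

/-- A (sequence in `m` of) `π₀`-estimator(s): measurable functions of the `p`-values with values
in `[0, ∞)`. -/
def IsPi0Estimator (π : (m : ℕ) → (Fin m → ℝ) → ℝ) : Prop :=
  ∀ m, Measurable (π m) ∧ ∀ p, 0 ≤ π m p

/-- The ordered `p`-values `0 =: p_(0) ≤ p_(1) ≤ … ≤ p_(m)` (used only for `k ≤ m`). -/
def orderStat {m : ℕ} (p : Fin m → ℝ) (k : ℕ) : ℝ :=
  if h : 0 < k ∧ k ≤ m then p (Tuple.sort p ⟨k - 1, by omega⟩) else 0

/-- The critical value `κ ∧ (α k / (m π))`, with the conventions `1 / 0 = +∞` and `0 · ∞ = 0`. -/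
def critVal (α κ : ℝ) (m : ℕ) (π : ℝ) (k : ℕ) : ℝ :=
  if π = 0 then (if k = 0 then 0 else κ) else min κ (α * k / (m * π))

open Classical in
/-- Number of rejections of the adaptive BH procedure, where `π` is the value of the estimator:
the largest `k ∈ {0, …, m}` with `p_(k) ≤ κ ∧ (α k / (m π))`. -/
def abhCount (α κ : ℝ) {m : ℕ} (π : ℝ) (p : Fin m → ℝ) : ℕ :=
  Nat.findGreatest (fun k => orderStat p k ≤ critVal α κ m π k) m

/-- Threshold `κ ∧ (α k̂ / (m π))` of the adaptive BH procedure. -/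
def abhThreshold (α κ : ℝ) {m : ℕ} (π : ℝ) (p : Fin m → ℝ) : ℝ :=
  critVal α κ m π (abhCount α κ π p)

open Classical in
/-- False discovery rate of `ABH_α(π, κ)` in the two-group model. -/
def FDR (θ : TwoGroup) (m : ℕ) (α κ : ℝ) (π : (Fin m → ℝ) → ℝ) : ℝ :=
  ∫ ω, ((Finset.univ.filter fun i : Fin m =>
        (ω i).1 = false ∧ (ω i).2 ≤ abhThreshold α κ (π (pvals ω)) (pvals ω)).card : ℝ)
      / ((max (abhCount α κ (π (pvals ω)) (pvals ω)) 1 : ℕ) : ℝ) ∂(θ.law m)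

open Classical in
/-- Power of `ABH_α(π, κ)` in the two-group model. -/
def Power (θ : TwoGroup) (m : ℕ) (α κ : ℝ) (π : (Fin m → ℝ) → ℝ) : ℝ :=
  ∫ ω, ((Finset.univ.filter fun i : Fin m =>
        (ω i).1 = true ∧ (ω i).2 ≤ abhThreshold α κ (π (pvals ω)) (pvals ω)).card : ℝ)
      / (m : ℝ) ∂(θ.law m)

/-- The estimator is FDR-conservative over `Θ` after `κ`-capping (`κ = 1`: no capping). -/
def FDRConservative (Θ : Set TwoGroup) (κ : ℝ) (π : (m : ℕ) → (Fin m → ℝ) → ℝ) : Prop :=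
  ∀ α ∈ Set.Ioo (0 : ℝ) 1, ∀ m : ℕ, 2 ≤ m → ∀ θ ∈ Θ, FDR θ m α κ (π m) ≤ α

/-- The estimator concentrates over `Θ` around `piBar θ > 0`, with precision `η m θ → 0` and error
probability `δ m θ → 0` (for each fixed `θ ∈ Θ`, as `m → ∞`). -/
def Concentrating (Θ : Set TwoGroup) (π : (m : ℕ) → (Fin m → ℝ) → ℝ)
    (piBar : TwoGroup → ℝ) (η δ : ℕ → TwoGroup → ℝ) : Prop :=
  (∀ θ ∈ Θ, 0 < piBar θ) ∧
  (∀ θ ∈ Θ, Tendsto (fun m => η m θ) atTop (𝓝 0)) ∧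
  (∀ θ ∈ Θ, Tendsto (fun m => δ m θ) atTop (𝓝 0)) ∧
  ∀ᶠ m in atTop, ∀ θ ∈ Θ,
    1 - δ m θ ≤ (θ.law m).real {ω | |π m (pvals ω) - piBar θ| ≤ η m θ}

/-- The least favorable null law `δ₀ × U(0,1)^{s-1}`. -/
def leastFavorable (s : ℕ) : Measure (Fin s → ℝ) :=
  Measure.pi fun i => if i.val = 0 then Measure.dirac 0 else volume.restrict (Set.Ioo 0 1)

open Classical in
/-- `c(s,ε)`: the expectation under `δ₀ × U(0,1)^{s-1}` of
`1 ∨ max_{x ∈ {qᵢ} ∩ (0,1-ε)} s (1 - x) / (1 ∨ #{i : qᵢ > x})`. The values in the maximum are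
positive, and `sSup ∅ = 0`, so that an empty maximum gives `1`. -/
def smallC (s : ℕ) (ε : ℝ) : ℝ :=
  ∫ q, max 1 (sSup ((fun x : ℝ => (s : ℝ) * (1 - x)
      / ((max 1 (Finset.univ.filter fun i : Fin s => x < q i).card : ℕ) : ℝ))
        '' (Set.range q ∩ Set.Ioo 0 (1 - ε)))) ∂(leastFavorable s)

/-- The normalizing factor `C(m,ε,b) = max {c(s,ε) : b m ≤ s ≤ m}`, where `b` is the lower bound
imposed on the estimator. -/
def bigC (m : ℕ) (ε b : ℝ) : ℝ :=
  sSup ((fun s : ℕ => smallC s ε) '' {s : ℕ | b * m ≤ s ∧ s ≤ m})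

open Classical in
/-- The Minimum-Storey estimator with parameters `ε` and `b`:
`b ∨ (C(m,ε,b) · inf_{x ∈ [0,1-ε]} (1 ∨ #{i : pᵢ ≥ x}) / (m (1 - x)))`. -/
def msEstimator (m : ℕ) (ε b : ℝ) (p : Fin m → ℝ) : ℝ :=
  max b (bigC m ε b * sInf ((fun x : ℝ =>
    ((max 1 (Finset.univ.filter fun i : Fin m => x ≤ p i).card : ℕ) : ℝ) / (m * (1 - x)))
      '' Set.Icc 0 (1 - ε)))

end MultTest

end

noncomputable section

namespace MultTest

/-! ### The adaptive BH procedure: measurability and monotonicity -/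

/-! The procedure depends on level and estimate only through their quotient, and more is rejected
when it grows. It therefore suffices to bound the competitor from below and the Minimum-Storey
estimator from above, both near `π₀*`.

Lower bound (`pi0Star_le_of_concentrating`): the `p`-values reveal only `F`, and every `r ∈ (0,1)`
with `r ≤ π₀*` is the null proportion of some parameter of `Θ` with the same `F`
(`exists_same_mixture`). If the estimator concentrated at a limit below `a < r`, then at level `a`
it would reject everything with high probability, and the FDR under that parameter would be nearly
`r > a`. So a conservative estimator can only concentrate at some `piBar ≥ π₀*`.

Upper bound (`msEstimator_le_of_card_lt`), with `e = m^{-1/4}`: an infimum is at most its value at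
one deterministic `x`. The Lipschitz density yields an `x ≤ 1 - e` whose population ratio exceeds
`π₀*` by `O(e)` (`exists_ratio_le`); one Chernoff bound controls the empirical ratio there outside
an event of probability `1/m`; and the normalizing factor is at most `1 + 9e` (`bigC_le_of_rate`).

The two factors in `α'` absorb the two errors (`level_mul_le`), and the exceptional events cost `1/m
+ δ` in power (`power_sub_power_le`). -/

lemma orderStat_le_iff {m : ℕ} (p : Fin m → ℝ) {k : ℕ} (hk : 0 < k) (hkm : k ≤ m) (c : ℝ) :
    orderStat p k ≤ c ↔ k ≤ (Finset.univ.filter fun i : Fin m => p i ≤ c).card := by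
  have h := Tuple.lt_card_le_iff_apply_le_of_monotone (j := (⟨k - 1, by omega⟩ : Fin m)) (a := c)
    (Tuple.monotone_sort p)
  have hcard : (Finset.univ.filter fun i : Fin m => (p ∘ Tuple.sort p) i ≤ c).card
      = (Finset.univ.filter fun i : Fin m => p i ≤ c).card :=
    Finset.card_bij (fun i _ => Tuple.sort p i) (by simp) (by simp) fun b hb =>
      ⟨(Tuple.sort p).symm b, by simpa using hb, by simp⟩
  rw [hcard] at h
  simp only [orderStat, hk, hkm, and_self, dite_true]
  simp only [Function.comp] at h
  rw [← h]
  omega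

lemma measurable_card_filter {Ω : Type*} [MeasurableSpace Ω] {n : ℕ} {P : Ω → Fin n → Prop}
    [∀ ω, DecidablePred (P ω)] (h : ∀ i, MeasurableSet {ω | P ω i}) :
    Measurable fun ω => (Finset.univ.filter (P ω)).card := by
  classical
  simp only [Finset.card_filter]
  refine Finset.measurable_sum _ fun i _ => ?_
  convert Measurable.ite (h i) (measurable_const (a := 1)) (measurable_const (a := 0)) using 2

lemma measurable_orderStat {m : ℕ} (k : ℕ) : Measurable fun p : Fin m → ℝ => orderStat p k := by
  by_cases hk : 0 < k ∧ k ≤ m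
  · refine measurable_of_Iic fun c => ?_
    have : (fun p : Fin m → ℝ => orderStat p k) ⁻¹' Set.Iic c
        = {p | k ≤ (Finset.univ.filter fun i : Fin m => p i ≤ c).card} := by
      ext p
      exact orderStat_le_iff p hk.1 hk.2 c
    rw [this]
    exact measurableSet_le measurable_const (measurable_card_filter fun i =>
      measurableSet_le (measurable_pi_apply i) measurable_const)
  · simp only [orderStat, hk, dite_false]
    exact measurable_const

lemma measurable_pvals {m : ℕ} : Measurable (pvals (m := m)) :=
  measurable_pi_lambda _ fun i => (measurable_pi_apply i).snd

lemma measurable_critVal {Ω : Type*} [MeasurableSpace Ω] {f : Ω → ℝ} {k : Ω → ℕ} (α κ : ℝ) (m : ℕ)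
    (hf : Measurable f) (hk : Measurable k) :
    Measurable fun ω => critVal α κ m (f ω) (k ω) := by
  have hk' : Measurable fun ω => (k ω : ℝ) := measurable_from_top.comp hk
  unfold critVal
  refine Measurable.ite (hf (measurableSet_singleton 0)) (Measurable.ite
    (hk (measurableSet_singleton 0)) measurable_const measurable_const) ?_
  exact measurable_const.min ((measurable_const.mul hk').div (measurable_const.mul hf))

lemma measurable_abhCount {m : ℕ} {π : (Fin m → ℝ) → ℝ} (hπ : Measurable π) (α κ : ℝ) :
    Measurable fun p : Fin m → ℝ => abhCount α κ (π p) p := by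
  classical
  unfold abhCount
  refine measurable_findGreatest fun k _ => measurableSet_le (measurable_orderStat k) ?_
  exact measurable_critVal α κ m hπ measurable_const

lemma measurable_abhThreshold {m : ℕ} {π : (Fin m → ℝ) → ℝ} (hπ : Measurable π) (α κ : ℝ) :
    Measurable fun p : Fin m → ℝ => abhThreshold α κ (π p) p :=
  measurable_critVal α κ m hπ (measurable_abhCount hπ α κ)

open Classical in
lemma measurable_rejections {m : ℕ} {π : (Fin m → ℝ) → ℝ} (hπ : Measurable π) (α κ : ℝ) (b : Bool) :
    Measurable fun ω : Fin m → Bool × ℝ =>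
    ((Finset.univ.filter fun i : Fin m =>
        (ω i).1 = b ∧ (ω i).2 ≤ abhThreshold α κ (π (pvals ω)) (pvals ω)).card : ℝ) := by
  refine measurable_from_top.comp (measurable_card_filter fun i => ?_)
  refine MeasurableSet.inter ?_ ?_
  · exact (measurable_pi_apply i).fst (measurableSet_singleton b)
  · exact measurableSet_le (measurable_pi_apply i).snd
      ((measurable_abhThreshold hπ α κ).comp measurable_pvals)

lemma critVal_mono (α : ℝ) (hα : 0 ≤ α) (m : ℕ) {π : ℝ} (hπ : 0 ≤ π) {k l : ℕ} (h : k ≤ l) :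
    critVal α 1 m π k ≤ critVal α 1 m π l := by
  unfold critVal
  split_ifs with h0 hk hl hl
  · rfl
  · norm_num
  · omega
  · rfl
  · refine min_le_min_left _ ?_
    gcongr

lemma abhThreshold_mono {α α' : ℝ} (hα : 0 ≤ α) {m : ℕ} {π π' : ℝ} (hπ : 0 ≤ π)
    (p : Fin m → ℝ) (h : ∀ k, critVal α' 1 m π' k ≤ critVal α 1 m π k) :
    abhThreshold α' 1 π' p ≤ abhThreshold α 1 π p :=
  (h _).trans (critVal_mono α hα m hπ
    (Nat.findGreatest_mono (fun k hk => le_trans hk (h k)) le_rfl))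

lemma critVal_le_critVal {α α' : ℝ} (m : ℕ) {π π' : ℝ} (hπ : 0 < π) (hπ' : 0 < π')
    (h : α' * π ≤ α * π') (k : ℕ) : critVal α' 1 m π' k ≤ critVal α 1 m π k := by
  simp only [critVal, hπ.ne', hπ'.ne', if_false]
  refine min_le_min_left _ ?_
  rcases Nat.eq_zero_or_pos m with rfl | hm
  · simp
  have hm' : (0 : ℝ) < m := by exact_mod_cast hm
  rw [div_le_div_iff₀ (by positivity) (by positivity)]
  have : (0 : ℝ) ≤ k * m := by positivity
  nlinarith

/-! ### Chernoff bounds for sums of independent indicators -/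

section Chernoff

variable {n : ℕ} {β : Type*} [MeasurableSpace β] (μ : Fin n → Measure β)
  [∀ i, IsProbabilityMeasure (μ i)] {A : Set β} [DecidablePred (· ∈ A)]

lemma measurable_card_mem (hA : MeasurableSet A) : Measurable fun ω : Fin n → β =>
    ((Finset.univ.filter fun i => ω i ∈ A).card : ℝ) :=
  measurable_from_top.comp (measurable_card_filter fun i => measurable_pi_apply i hA)

lemma integrable_exp_card (hA : MeasurableSet A) (t : ℝ) :
    Integrable (fun ω : Fin n → β =>
      Real.exp (t * ((Finset.univ.filter fun i => ω i ∈ A).card : ℝ))) (Measure.pi μ) := by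
  refine Integrable.of_bound (C := Real.exp (|t| * n))
    (Real.measurable_exp.comp ((measurable_card_mem hA).const_mul t)).aestronglyMeasurable
    (Eventually.of_forall fun ω => ?_)
  rw [Real.norm_eq_abs, Real.abs_exp]
  refine Real.exp_le_exp.2 (mul_le_mul (le_abs_self t) ?_ (by positivity) (abs_nonneg t))
  exact_mod_cast (Finset.card_le_univ _).trans (by simp)

/-- By independence the transform is a product of factors `1 + μᵢ(A)(eᵗ - 1)`; then `eᵗ - 1 ≤ t +
t²` for `|t| ≤ 1` and `1 + y ≤ e^y`. Both signs of `t` are needed, one per tail, and the laws may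
differ because the least favorable law has an atom in its first coordinate. -/
lemma mgf_card_le (hA : MeasurableSet A) {t : ℝ} (ht : |t| ≤ 1) :
    mgf (fun ω : Fin n → β => ((Finset.univ.filter fun i => ω i ∈ A).card : ℝ)) (Measure.pi μ) t
      ≤ Real.exp ((t + t ^ 2) * ∑ i, (μ i).real A) := by
  have h1 : ∀ ω : Fin n → β, Real.exp (t * ((Finset.univ.filter fun i => ω i ∈ A).card : ℝ))
      = ∏ i, (1 + A.indicator (fun _ => Real.exp t - 1) (ω i)) := by
    intro ω
    rw [Finset.card_filter]
    push_cast
    rw [Finset.mul_sum, Real.exp_sum]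
    refine Finset.prod_congr rfl fun i _ => ?_
    by_cases hi : ω i ∈ A <;> simp [hi]
  unfold mgf
  simp_rw [h1]
  rw [integral_fintype_prod_eq_prod (fun (_ : Fin n) x =>
    1 + A.indicator (fun _ => Real.exp t - 1) x), Finset.mul_sum, Real.exp_sum]
  have h2 : ∀ i, ∫ x, (1 + A.indicator (fun _ => Real.exp t - 1) x) ∂(μ i)
      = 1 + (μ i).real A * (Real.exp t - 1) := by
    intro i
    rw [integral_add (integrable_const _) ((integrable_const _).indicator hA),
      integral_indicator_const _ hA]
    simp
  have h3 : Real.exp t - 1 ≤ t + t ^ 2 := by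
    have := abs_le.1 (Real.abs_exp_sub_one_sub_id_le ht)
    linarith [this.2]
  refine Finset.prod_le_prod (fun i _ => ?_) fun i _ => ?_
  · rw [h2]
    nlinarith [Real.exp_pos t, measureReal_nonneg (μ := μ i) (s := A),
      measureReal_le_one (μ := μ i) (s := A)]
  · rw [h2]
    have := Real.add_one_le_exp ((t + t ^ 2) * (μ i).real A)
    nlinarith [measureReal_nonneg (μ := μ i) (s := A)]

lemma real_card_ge_le (hA : MeasurableSet A) {t u : ℝ} (ht0 : 0 ≤ t) (ht1 : t ≤ 1) :
    (Measure.pi μ).real {ω | (∑ i, (μ i).real A) + u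
        ≤ ((Finset.univ.filter fun i => ω i ∈ A).card : ℝ)}
      ≤ Real.exp (t ^ 2 * n - t * u) := by
  refine (measure_ge_le_exp_mul_mgf _ ht0 (integrable_exp_card μ hA t)).trans ?_
  refine (mul_le_mul_of_nonneg_left (mgf_card_le μ hA (by rwa [abs_of_nonneg ht0]))
    (Real.exp_pos _).le).trans ?_
  rw [← Real.exp_add]
  refine Real.exp_le_exp.2 ?_
  have : ∑ i, (μ i).real A ≤ n := by
    simpa using Finset.sum_le_sum fun (i : Fin n) (_ : i ∈ Finset.univ) =>
      measureReal_le_one (μ := μ i) (s := A)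
  nlinarith [sq_nonneg t]

lemma real_card_le_le (hA : MeasurableSet A) {t : ℝ} (ht0 : 0 ≤ t) (ht1 : t ≤ 1) :
    (Measure.pi μ).real {ω | ((Finset.univ.filter fun i => ω i ∈ A).card : ℝ)
        ≤ (1 - 2 * t) * ∑ i, (μ i).real A}
      ≤ Real.exp (-(t ^ 2 * ∑ i, (μ i).real A)) := by
  refine (measure_le_le_exp_mul_mgf (t := -t) _ (by linarith)
    (integrable_exp_card μ hA (-t))).trans ?_
  refine (mul_le_mul_of_nonneg_left (mgf_card_le μ hA (by rwa [abs_neg, abs_of_nonneg ht0]))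
    (Real.exp_pos _).le).trans ?_
  rw [← Real.exp_add]
  refine Real.exp_le_exp.2 (le_of_eq ?_)
  ring

end Chernoff

/-! ### The normalizing factor of the Minimum-Storey estimator -/

instance (s : ℕ) (i : Fin s) : IsProbabilityMeasure
    (if i.val = 0 then Measure.dirac 0 else (volume : Measure ℝ).restrict (Set.Ioo 0 1)) := by
  split_ifs
  · infer_instance
  · exact ⟨by simp⟩

instance (s : ℕ) : IsProbabilityMeasure (leastFavorable s) := by
  unfold leastFavorable
  infer_instance

lemma sum_leastFavorable_Ioi {s : ℕ} (hs : 0 < s) {y : ℝ} (hy : y ∈ Set.Icc (0 : ℝ) 1) :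
    ∑ i : Fin s, (if i.val = 0 then Measure.dirac 0
      else (volume : Measure ℝ).restrict (Set.Ioo 0 1)).real (Set.Ioi y) = (s - 1) * (1 - y) := by
  obtain ⟨n, rfl⟩ : ∃ n, s = n + 1 := ⟨s - 1, by omega⟩
  rw [Fin.sum_univ_succ]
  have h0 : Set.Ioi y ∩ Set.Ioo 0 1 = Set.Ioo y 1 := by
    ext x
    simp only [Set.mem_inter_iff, Set.mem_Ioi, Set.mem_Ioo]
    exact ⟨fun h => ⟨h.1, h.2.2⟩, fun h => ⟨h.1, hy.1.trans_lt h.1, h.2⟩⟩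
  have h1 : (Measure.dirac (0 : ℝ)).real (Set.Ioi y) = 0 := by
    simp [measureReal_def, hy.1]
  have h2 : ((volume : Measure ℝ).restrict (Set.Ioo 0 1)).real (Set.Ioi y) = 1 - y := by
    rw [measureReal_restrict_apply measurableSet_Ioi, h0, Real.volume_real_Ioo_of_le hy.2]
  simp [h1, h2]
  ring

/-- Three relative losses are collected: `1 - e` from rounding `x` to a grid, `1 - e` from `s - 1`
in place of `s`, and `1 - 2e` from the deviation. Their product is at least `1 - 4e`, and `(1 +
8e)(1 - 4e) ≥ 1` exactly because `e ≤ 1/8`. -/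
lemma ratio_le_of_card_gt {s N : ℕ} {e x z : ℝ} (he0 : 0 < e) (he : e ≤ 1 / 8)
    (hs : 1 ≤ e * s) (hx : 0 ≤ x) (hz : (1 - e) * x ≤ z)
    (hN : (1 - 2 * e) * ((s - 1) * z) ≤ N) :
    s * x / ((max 1 N : ℕ) : ℝ) ≤ 1 + 8 * e := by
  have hM : (N : ℝ) ≤ ((max 1 N : ℕ) : ℝ) := by exact_mod_cast le_max_right _ _
  have hM1 : (1 : ℝ) ≤ ((max 1 N : ℕ) : ℝ) := by exact_mod_cast le_max_left _ _
  rw [div_le_iff₀ (by linarith)]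
  have hsx : (0 : ℝ) ≤ s * x := by positivity
  have h1 : (1 - e) * s * ((1 - e) * x) ≤ (s - 1) * z :=
    mul_le_mul (by linarith) hz (mul_nonneg (by linarith) hx) (by nlinarith)
  have h2 : (1 - 2 * e) * ((1 - e) * s * ((1 - e) * x)) ≤ ((max 1 N : ℕ) : ℝ) :=
    (mul_le_mul_of_nonneg_left h1 (by linarith)).trans (hN.trans hM)
  have h3 : 1 ≤ (1 + 8 * e) * ((1 - 2 * e) * ((1 - e) * (1 - e))) := by
    have h4 : 1 - 4 * e ≤ (1 - 2 * e) * ((1 - e) * (1 - e)) := by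
      nlinarith [mul_nonneg he0.le he0.le, mul_nonneg (mul_nonneg he0.le he0.le)
          (by linarith : (0 : ℝ) ≤ 1 - e)]
    have := mul_le_mul_of_nonneg_left h4 (by linarith : 0 ≤ 1 + 8 * e)
    nlinarith
  calc s * x ≤ (1 + 8 * e) * ((1 - 2 * e) * ((1 - e) * (1 - e))) * (s * x) :=
        le_mul_of_one_le_left hsx h3
    _ = (1 + 8 * e) * ((1 - 2 * e) * ((1 - e) * s * ((1 - e) * x))) := by ring
    _ ≤ _ := mul_le_mul_of_nonneg_left h2 (by linarith)

open Classical in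
-- A union bound over a grid of mesh `1/m ≤ e²` makes the ratio at most `1 + 8e` everywhere; on the
-- exceptional event `B` the ratio is still at most `s`.
lemma smallC_le {s m : ℕ} {e : ℝ} (he0 : 0 < e) (he : e ≤ 1 / 8) (hm : 1 ≤ e ^ 2 * m)
    (hs : 1 ≤ e * s) :
    smallC s e ≤ 1 + 8 * e + s * (m * Real.exp (-(e ^ 2 * ((s - 1) * (e / 2))))) := by
  have hs0 : (1 : ℝ) ≤ s := by nlinarith
  have hs0' : 0 < s := by exact_mod_cast (by linarith : (0 : ℝ) < s)
  have hm0 : (0 : ℝ) < m := by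
    rcases (Nat.cast_nonneg m : (0 : ℝ) ≤ m).lt_or_eq with h | h
    · exact h
    · rw [← h] at hm
      norm_num at hm
  let y : ℕ → ℝ := fun k => (k + 1) / m
  -- Staying `e/2` away from `1` keeps the mean counts at least `(s - 1) e / 2`, while still leaving
  -- a grid point just above every `x < 1 - e`.
  let I := (Finset.range m).filter fun k => e / 2 ≤ 1 - y k
  let T : ℕ → Set (Fin s → ℝ) := fun k => {q |
    ((Finset.univ.filter fun i => q i ∈ Set.Ioi (y k)).card : ℝ)
      ≤ (1 - 2 * e) * ((s - 1) * (1 - y k))}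
  let B : Set (Fin s → ℝ) := ⋃ k ∈ I, T k
  have hBm : MeasurableSet B := Finset.measurableSet_biUnion _ fun k _ =>
    measurableSet_le (measurable_card_mem measurableSet_Ioi) measurable_const
  have hB : (leastFavorable s).real B ≤ m * Real.exp (-(e ^ 2 * ((s - 1) * (e / 2)))) := by
    refine (measureReal_biUnion_finset_le _ _).trans ?_
    have hI : (I.card : ℝ) ≤ m := by
      exact_mod_cast (Finset.card_filter_le _ _).trans (by simp)
    refine (Finset.sum_le_card_nsmul _ _ (Real.exp (-(e ^ 2 * ((s - 1) * (e / 2)))))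
      fun k hk => ?_).trans ?_
    · have hk' : e / 2 ≤ 1 - y k := (Finset.mem_filter.1 hk).2
      have hyk : y k ∈ Set.Icc (0 : ℝ) 1 := ⟨by positivity, by linarith⟩
      have := real_card_le_le (fun i : Fin s => if i.val = 0 then Measure.dirac 0
        else (volume : Measure ℝ).restrict (Set.Ioo 0 1)) (A := Set.Ioi (y k)) measurableSet_Ioi
        he0.le (by linarith)
      rw [sum_leastFavorable_Ioi hs0' hyk] at this
      refine this.trans (Real.exp_le_exp.2 (neg_le_neg ?_))
      gcongr
    · rw [nsmul_eq_mul]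
      gcongr
  have hpt : ∀ q : Fin s → ℝ, max 1 (sSup ((fun x : ℝ => (s : ℝ) * (1 - x)
      / ((max 1 (Finset.univ.filter fun i : Fin s => x < q i).card : ℕ) : ℝ))
        '' (Set.range q ∩ Set.Ioo 0 (1 - e)))) ≤ 1 + 8 * e + B.indicator (fun _ => (s : ℝ)) q := by
    intro q
    by_cases hq : q ∈ B
    · rw [Set.indicator_of_mem hq]
      refine max_le (by linarith) (Real.sSup_le ?_ (by linarith))
      rintro _ ⟨x, ⟨-, hx0, hx1⟩, rfl⟩
      have hM1 : (1 : ℝ) ≤ ((max 1 (Finset.univ.filter fun i : Fin s => x < q i).card : ℕ) : ℝ) := by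
        exact_mod_cast le_max_left _ _
      refine (div_le_self (mul_nonneg (by linarith) (by linarith)) hM1).trans ?_
      nlinarith
    · rw [Set.indicator_of_notMem hq, add_zero]
      refine max_le (by linarith) (Real.sSup_le ?_ (by linarith))
      rintro _ ⟨x, ⟨-, hx0, hx1⟩, rfl⟩
      have hk1 : (⌊x * m⌋₊ : ℝ) ≤ x * m := Nat.floor_le (by positivity)
      have hk2 : x * m < ⌊x * m⌋₊ + 1 := Nat.lt_floor_add_one _
      have hy1 : x < y ⌊x * m⌋₊ := (lt_div_iff₀ hm0).2 hk2
      have hy2 : y ⌊x * m⌋₊ ≤ x + e ^ 2 := by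
        rw [div_le_iff₀ hm0]
        linarith
      have hz : (1 - e) * (1 - x) ≤ 1 - y ⌊x * m⌋₊ := by nlinarith
      have hkI : ⌊x * m⌋₊ ∈ I := by
        refine Finset.mem_filter.2 ⟨Finset.mem_range.2 ?_, by nlinarith⟩
        rw [Nat.floor_lt (by positivity)]
        nlinarith
      have hT : q ∉ T ⌊x * m⌋₊ := fun h => hq (Set.mem_biUnion hkI h)
      refine ratio_le_of_card_gt he0 he hs (by linarith) hz ((not_le.1 hT).le.trans ?_)
      exact_mod_cast Finset.card_le_card fun i hi => by
        simp only [Finset.mem_filter, Finset.mem_univ, true_and, Set.mem_Ioi] at hi ⊢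
        exact hy1.trans hi
  have hint : Integrable (B.indicator fun _ => (s : ℝ)) (leastFavorable s) :=
    (integrable_const _).indicator hBm
  calc smallC s e ≤ ∫ q, (1 + 8 * e + B.indicator (fun _ => (s : ℝ)) q) ∂(leastFavorable s) :=
        integral_mono_of_nonneg (Eventually.of_forall fun q => zero_le_one.trans (le_max_left _ _))
          ((integrable_const _).add hint) (Eventually.of_forall hpt)
    _ = 1 + 8 * e + (leastFavorable s).real B * s := by
        rw [integral_add (integrable_const _) hint, integral_indicator_const _ hBm]
        simp
    _ ≤ _ := by
        rw [mul_comm (s : ℝ)]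
        gcongr

lemma bigC_nonneg (m : ℕ) (e b : ℝ) : 0 ≤ bigC m e b := by
  refine Real.sSup_nonneg ?_
  rintro _ ⟨s, -, rfl⟩
  exact integral_nonneg fun q => zero_le_one.trans (le_max_left _ _)

lemma bigC_le {m : ℕ} {e b : ℝ} (he0 : 0 < e) (he : e ≤ 1 / 8) (hm : 1 ≤ e ^ 2 * m)
    (hb : 1 ≤ e * (b * m)) (hexp : m * (m * Real.exp (-(e ^ 2 * ((b * m - 1) * (e / 2))))) ≤ e) :
    bigC m e b ≤ 1 + 9 * e := by
  refine Real.sSup_le ?_ (by linarith)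
  rintro _ ⟨s, ⟨hs1, hs2⟩, rfl⟩
  have hs2' : (s : ℝ) ≤ m := by exact_mod_cast hs2
  refine (smallC_le he0 he hm (hb.trans (by gcongr))).trans ?_
  -- The prefactor is worst at `s = m`, the exponential at `s = b m`.
  have : (s : ℝ) * (m * Real.exp (-(e ^ 2 * ((s - 1) * (e / 2))))) ≤ e := by
    refine le_trans ?_ hexp
    gcongr
  linarith

/-! ### The mixture distribution function and the law of the `p`-values -/

lemma measureReal_mixture {β : Type*} [MeasurableSpace β] (ν ν' : Measure β) [IsFiniteMeasure ν]
    [IsFiniteMeasure ν'] {a b : ℝ} (ha : 0 ≤ a) (hb : 0 ≤ b) (S : Set β) :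
    (ENNReal.ofReal a • ν + ENNReal.ofReal b • ν').real S = a * ν.real S + b * ν'.real S := by
  simp only [measureReal_def, Measure.add_apply, Measure.smul_apply, smul_eq_mul]
  rw [ENNReal.toReal_add (ENNReal.mul_ne_top (by simp) (measure_ne_top _ _))
    (ENNReal.mul_ne_top (by simp) (measure_ne_top _ _))]
  simp [ha, hb]

namespace TwoGroup

variable (θ : TwoGroup)

lemma one_sub_pi0_nonneg : 0 ≤ 1 - θ.pi0 := sub_nonneg.2 θ.pi0_mem.2

lemma continuous_F : Continuous θ.F :=
  (continuous_const.mul θ.cont0).add (continuous_const.mul θ.cont1)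

lemma monotone_F : Monotone θ.F := fun _ _ h =>
  add_le_add (mul_le_mul_of_nonneg_left (monotone_cdf θ.nu0 h) θ.pi0_mem.1)
    (mul_le_mul_of_nonneg_left (monotone_cdf θ.nu1 h) θ.one_sub_pi0_nonneg)

lemma F_nonneg (x : ℝ) : 0 ≤ θ.F x :=
  add_nonneg (mul_nonneg θ.pi0_mem.1 (cdf_nonneg _ _))
    (mul_nonneg θ.one_sub_pi0_nonneg (cdf_nonneg _ _))

lemma F_le_one (x : ℝ) : θ.F x ≤ 1 := by
  have h0 := mul_le_mul_of_nonneg_left (cdf_le_one θ.nu0 x) θ.pi0_mem.1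
  have h1 := mul_le_mul_of_nonneg_left (cdf_le_one θ.nu1 x) θ.one_sub_pi0_nonneg
  unfold F
  linarith

lemma cdf_one_of_support (ν : Measure ℝ) [IsProbabilityMeasure ν] (h : ν (Set.Icc 0 1) = 1) :
    cdf ν 1 = 1 := by
  refine le_antisymm (cdf_le_one _ _) ?_
  rw [cdf_eq_real, measureReal_def]
  have : ν (Set.Iic 1) = 1 := le_antisymm prob_le_one (h ▸ measure_mono Set.Icc_subset_Iic_self)
  simp [this]

lemma F_one : θ.F 1 = 1 := by
  simp [F, cdf_one_of_support _ θ.supp0, cdf_one_of_support _ θ.supp1]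

/-- The common law of the `p`-values. -/
def pvalLaw : Measure ℝ := θ.pairLaw.map Prod.snd

instance : IsProbabilityMeasure θ.pvalLaw :=
  Measure.isProbabilityMeasure_map measurable_snd.aemeasurable

lemma pvalLaw_eq :
    θ.pvalLaw = ENNReal.ofReal θ.pi0 • θ.nu0 + ENNReal.ofReal (1 - θ.pi0) • θ.nu1 := by
  simp [pvalLaw, pairLaw, Measure.map_add _ _ measurable_snd]

lemma cdf_pvalLaw (x : ℝ) : cdf θ.pvalLaw x = θ.F x := by
  rw [cdf_eq_real, pvalLaw_eq, measureReal_mixture _ _ θ.pi0_mem.1 θ.one_sub_pi0_nonneg,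
    ← cdf_eq_real, ← cdf_eq_real, F]

lemma pvalLaw_congr {θ θ' : TwoGroup} (h : θ.F = θ'.F) : θ.pvalLaw = θ'.pvalLaw := by
  refine Measure.eq_of_cdf _ _ ?_
  ext x
  rw [cdf_pvalLaw, cdf_pvalLaw, h]

lemma map_pvals_law (m : ℕ) : (θ.law m).map pvals = Measure.pi fun _ => θ.pvalLaw := by
  have : IsProbabilityMeasure (θ.pairLaw.map Prod.snd) := inferInstanceAs
    (IsProbabilityMeasure θ.pvalLaw)
  exact Measure.pi_map_pi (μ := fun _ : Fin m => θ.pairLaw) (f := fun _ => Prod.snd)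
    fun _ => measurable_snd.aemeasurable

instance (m : ℕ) : IsProbabilityMeasure (θ.law m) := by
  unfold law
  infer_instance

/-- Non-identifiability: an estimator sees only `p`-values, so it behaves identically under
parameters sharing `F`. -/
lemma real_law_pvals_congr {θ θ' : TwoGroup} (h : θ.F = θ'.F) {m : ℕ} {S : Set (Fin m → ℝ)}
    (hS : MeasurableSet S) :
    (θ.law m).real {ω | pvals ω ∈ S} = (θ'.law m).real {ω | pvals ω ∈ S} := by
  have key : ∀ θ : TwoGroup, (θ.law m).real {ω | pvals ω ∈ S}
      = (Measure.pi fun _ : Fin m => θ.pvalLaw).real S := fun θ => by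
    rw [← map_pvals_law, map_measureReal_apply measurable_pvals hS]
    rfl
  rw [key, key, pvalLaw_congr h]

lemma pvalLaw_Icc : θ.pvalLaw (Set.Icc 0 1) = 1 := by
  rw [pvalLaw_eq]
  simp only [Measure.add_apply, Measure.smul_apply, θ.supp0, θ.supp1, smul_eq_mul, mul_one]
  rw [← ENNReal.ofReal_add θ.pi0_mem.1 θ.one_sub_pi0_nonneg]
  simp

lemma ae_pvals_le_one (m : ℕ) : ∀ᵐ ω ∂(θ.law m), ∀ i, pvals ω i ≤ 1 := by
  refine ae_all_iff.2 fun i => ?_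
  have h1 : ∀ᵐ x ∂θ.pvalLaw, x ≤ 1 := by
    have : ∀ᵐ x ∂θ.pvalLaw, x ∈ Set.Icc (0 : ℝ) 1 :=
      (prob_compl_eq_zero_iff measurableSet_Icc).2 θ.pvalLaw_Icc
    exact this.mono fun x hx => hx.2
  have h2 : ∀ᵐ z ∂θ.pairLaw, z.2 ≤ 1 := ae_of_ae_map measurable_snd.aemeasurable h1
  exact (measurePreserving_eval (fun _ : Fin m => θ.pairLaw) i).quasiMeasurePreserving.ae h2

/-- The estimator counts `pᵢ ≥ x`, so an atom at `x` must be excluded; continuity of `F` does this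
through left limits. -/
lemma pvalLaw_real_Ici_le (x : ℝ) : θ.pvalLaw.real (Set.Ici x) ≤ 1 - θ.F x := by
  have h : θ.F x ≤ θ.pvalLaw.real (Set.Iio x) := by
    refine le_of_tendsto (θ.continuous_F.continuousWithinAt (s := Set.Iio x) (x := x)) ?_
    filter_upwards [self_mem_nhdsWithin] with z hz
    rw [← cdf_pvalLaw, cdf_eq_real]
    exact measureReal_mono fun w hw =>
      lt_of_le_of_lt (Set.mem_Iic.1 hw) (Set.mem_Iio.1 hz)
  have := probReal_compl_eq_one_sub (μ := θ.pvalLaw) (measurableSet_Iio (a := x))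
  rw [Set.compl_Iio] at this
  linarith

lemma pairLaw_real_fst_false : θ.pairLaw.real {z | z.1 = false} = θ.pi0 := by
  have h : {z : Bool × ℝ | z.1 = false} = {false} ×ˢ Set.univ := by
    ext z
    simp
  rw [h, pairLaw, measureReal_mixture _ _ θ.pi0_mem.1 θ.one_sub_pi0_nonneg,
    measureReal_prod_prod, measureReal_prod_prod]
  simp [measureReal_def]

open Classical in
lemma integral_null_proportion {m : ℕ} (hm : 0 < m) :
    ∫ ω, ((Finset.univ.filter fun i : Fin m => (ω i).1 = false).card : ℝ) / m ∂(θ.law m)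
      = θ.pi0 := by
  have hA : MeasurableSet {z : Bool × ℝ | z.1 = false} := measurable_fst (measurableSet_singleton _)
  have h1 : ∀ ω : Fin m → Bool × ℝ, ((Finset.univ.filter fun i : Fin m => (ω i).1 = false).card : ℝ)
      = ∑ i, (Function.eval i ⁻¹' {z : Bool × ℝ | z.1 = false}).indicator (fun _ => (1 : ℝ)) ω := by
    intro ω
    rw [Finset.card_filter]
    push_cast
    exact Finset.sum_congr rfl fun i _ => by simp [Set.indicator_apply]
  have h2 : ∀ i : Fin m, (θ.law m).real (Function.eval i ⁻¹' {z : Bool × ℝ | z.1 = false})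
      = θ.pi0 := fun i => by
    rw [← pairLaw_real_fst_false, measureReal_def, measureReal_def]
    congr 1
    exact (measurePreserving_eval (fun _ : Fin m => θ.pairLaw) i).measure_preimage
      hA.nullMeasurableSet
  have hA' : ∀ i : Fin m, MeasurableSet (Function.eval i ⁻¹' {z : Bool × ℝ | z.1 = false}) :=
    fun i => by
      have h : Measurable (Function.eval i : (Fin m → Bool × ℝ) → Bool × ℝ) := measurable_pi_apply i
      have h' := h hA
      exact h'
  have hm' : (m : ℝ) ≠ 0 := by exact_mod_cast hm.ne'
  simp_rw [h1]
  rw [integral_div, integral_finsetSum _ fun i _ => (integrable_const _).indicator (hA' i)]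
  simp_rw [fun i => integral_indicator_const (μ := θ.law m) (1 : ℝ) (hA' i), h2]
  simp
  field_simp

end TwoGroup

/-! ### The largest null proportion compatible with the mixture -/

section Params

variable {θ : TwoGroup}

lemma F_zero (hθ : θ ∈ superUnifParams) : θ.F 0 = 0 := by
  obtain ⟨-, -, f, -, -, hf⟩ := hθ
  rw [hf 0 (by simp)]
  simp

lemma F_of_nonpos (hθ : θ ∈ superUnifParams) {x : ℝ} (hx : x ≤ 0) : θ.F x = 0 :=
  le_antisymm (F_zero hθ ▸ θ.monotone_F hx) (θ.F_nonneg x)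

lemma pi0_mul_le (hθ : θ ∈ superUnifParams) {x : ℝ} (hx : x ∈ Set.Icc (0 : ℝ) 1) :
    θ.pi0 * (1 - x) ≤ 1 - θ.F x := by
  have h0 := mul_le_mul_of_nonneg_left (hθ.2.1 x hx) θ.pi0_mem.1
  have h1 := mul_le_mul_of_nonneg_left (cdf_le_one θ.nu1 x) θ.one_sub_pi0_nonneg
  unfold TwoGroup.F
  linarith

lemma pi0_mem_lowerBounds (hθ : θ ∈ superUnifParams) :
    θ.pi0 ∈ lowerBounds ((fun x : ℝ => (1 - θ.F x) / (1 - x)) '' Set.Ico 0 1) := by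
  rintro _ ⟨x, hx, rfl⟩
  exact (le_div_iff₀ (sub_pos.2 hx.2)).2 (pi0_mul_le hθ ⟨hx.1, hx.2.le⟩)

lemma pi0Star_pos (hθ : θ ∈ superUnifParams) : 0 < θ.pi0Star :=
  hθ.1.trans_le (le_csInf ⟨_, Set.mem_image_of_mem _ (Set.left_mem_Ico.2 zero_lt_one)⟩
    (pi0_mem_lowerBounds hθ))

lemma pi0Star_le_ratio (hθ : θ ∈ superUnifParams) {x : ℝ} (hx : x ∈ Set.Ico (0 : ℝ) 1) :
    θ.pi0Star ≤ (1 - θ.F x) / (1 - x) :=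
  csInf_le ⟨_, pi0_mem_lowerBounds hθ⟩ (Set.mem_image_of_mem _ hx)

lemma pi0Star_le_one (hθ : θ ∈ superUnifParams) : θ.pi0Star ≤ 1 := by
  simpa [F_zero hθ] using pi0Star_le_ratio hθ (Set.left_mem_Ico.2 zero_lt_one)

lemma pi0Star_mul_le (hθ : θ ∈ superUnifParams) {x : ℝ} (hx : x ∈ Set.Icc (0 : ℝ) 1) :
    θ.pi0Star * (1 - x) ≤ 1 - θ.F x := by
  rcases hx.2.lt_or_eq with h | rfl
  · exact (le_div_iff₀ (sub_pos.2 h)).1 (pi0Star_le_ratio hθ ⟨hx.1, h⟩)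
  · simp [θ.F_one]

/-- The infimum defining `π₀*` is approximated linearly in `e` on `[0, 1 - e]`. -/
lemma exists_ratio_le (hθ : θ ∈ superUnifParams) :
    ∃ K : ℝ, 0 ≤ K ∧ ∀ e ∈ Set.Ioc (0 : ℝ) 1, ∃ x ∈ Set.Icc (0 : ℝ) (1 - e),
      1 - θ.F x ≤ (θ.pi0Star + K * e) * (1 - x) := by
  obtain ⟨-, -, f, ⟨L, hL⟩, -, hf⟩ := id hθ
  refine ⟨2 * L + 1, by positivity, fun e he => ?_⟩
  have hcont : ContinuousOn f (Set.Icc 0 1) := hL.continuousOn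
  have hint : ∀ x ∈ Set.Icc (0 : ℝ) 1, IntervalIntegrable f volume x 1 := fun x hx =>
    (hcont.mono (Set.Icc_subset_Icc_left hx.1)).intervalIntegrable_of_Icc hx.2
  have hint0 : ∀ x ∈ Set.Icc (0 : ℝ) 1, IntervalIntegrable f volume 0 x := fun x hx =>
    (hcont.mono (Set.Icc_subset_Icc_right hx.2)).intervalIntegrable_of_Icc hx.1
  have htail : ∀ x ∈ Set.Icc (0 : ℝ) 1, 1 - θ.F x = ∫ t in x..1, f t := fun x hx => by
    have h1 := hf 1 (by simp)
    rw [θ.F_one] at h1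
    rw [hf x hx, ← intervalIntegral.integral_interval_sub_left (hint0 1 (by simp)) (hint0 x hx),
      ← h1]
  have hnear : ∀ x ∈ Set.Icc (1 - e) 1, ∀ t ∈ Set.Icc x 1, |f t - f 1| ≤ L * e := by
    intro x hx t ht
    have := hL.dist_le_mul t ⟨by linarith [he.2, hx.1, ht.1], ht.2⟩ 1 (by simp)
    rw [Real.dist_eq, Real.dist_eq] at this
    refine this.trans (mul_le_mul_of_nonneg_left ?_ L.2)
    rw [abs_le]
    constructor <;> linarith [hx.1, ht.1, ht.2, he.1]
  have hsub : ∀ x ∈ Set.Icc (1 - e) 1, x ∈ Set.Icc (0 : ℝ) 1 :=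
    fun x hx => ⟨by linarith [hx.1, he.2], hx.2⟩
  have hup : ∀ x ∈ Set.Icc (1 - e) 1, 1 - θ.F x ≤ (f 1 + L * e) * (1 - x) := by
    intro x hx
    rw [htail x (hsub x hx)]
    refine (intervalIntegral.integral_mono_on hx.2 (hint x (hsub x hx))
      (_root_.intervalIntegrable_const (c := f 1 + L * e)) fun t ht => ?_).trans (le_of_eq ?_)
    · linarith [(abs_le.1 (hnear x hx t ht)).2]
    · rw [intervalIntegral.integral_const, smul_eq_mul]
      ring
  have hlo : ∀ x ∈ Set.Icc (1 - e) 1, (f 1 - L * e) * (1 - x) ≤ 1 - θ.F x := by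
    intro x hx
    rw [htail x (hsub x hx)]
    refine (le_of_eq ?_).trans (intervalIntegral.integral_mono_on hx.2
      (_root_.intervalIntegrable_const (c := f 1 - L * e)) (hint x (hsub x hx)) fun t ht => ?_)
    · rw [intervalIntegral.integral_const, smul_eq_mul]
      ring
    · linarith [(abs_le.1 (hnear x hx t ht)).1]
  obtain ⟨_, ⟨x, hx, rfl⟩, hxlt⟩ := exists_lt_of_csInf_lt
    ⟨_, Set.mem_image_of_mem (fun x : ℝ => (1 - θ.F x) / (1 - x))
      (Set.left_mem_Ico.2 zero_lt_one)⟩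
    (show sInf ((fun x : ℝ => (1 - θ.F x) / (1 - x)) '' Set.Ico 0 1) < θ.pi0Star + e from
      lt_add_of_pos_right _ he.1)
  have hx1 : 0 < 1 - x := sub_pos.2 hx.2
  rw [div_lt_iff₀ hx1] at hxlt
  have hLe : 0 ≤ (L : ℝ) * e := mul_nonneg L.2 he.1.le
  rcases le_or_gt x (1 - e) with h | h
  · refine ⟨x, ⟨hx.1, h⟩, hxlt.le.trans ?_⟩
    gcongr
    nlinarith [he.1]
  -- A near-minimizer inside `(1 - e, 1)` forces `f 1 ≤ π₀* + e + L e`, since its ratio is an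
  -- average of `f` near `1`. The ratio at `1 - e` is at most `f 1 + L e`, whence `K = 2L + 1`.
  · refine ⟨1 - e, ⟨by linarith [he.2], le_rfl⟩, ?_⟩
    refine (hup (1 - e) ⟨le_rfl, by linarith [he.1]⟩).trans ?_
    have h1 := (hlo x ⟨h.le, hx.2.le⟩).trans hxlt.le
    have h2 : f 1 - L * e ≤ θ.pi0Star + e := le_of_mul_le_mul_right h1 hx1
    refine mul_le_mul_of_nonneg_right ?_ (by linarith [he.1])
    linarith

lemma exists_law_of_cdf {g : ℝ → ℝ} (hg : Monotone g) (hc : Continuous g)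
    (h0 : ∀ x ≤ 0, g x = 0) (h1 : ∀ x, 1 ≤ x → g x = 1) :
    ∃ ν : Measure ℝ, IsProbabilityMeasure ν ∧ ν (Set.Icc 0 1) = 1 ∧ ∀ x, cdf ν x = g x := by
  let G : StieltjesFunction ℝ := ⟨g, hg, fun x => hc.continuousWithinAt⟩
  have hbot : Tendsto G atBot (𝓝 0) := tendsto_const_nhds.congr'
    ((eventually_le_atBot 0).mono fun x hx => (h0 x hx).symm)
  have htop : Tendsto G atTop (𝓝 1) := tendsto_const_nhds.congr'
    ((eventually_ge_atTop 1).mono fun x hx => (h1 x hx).symm)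
  refine ⟨G.measure, G.isProbabilityMeasure hbot htop, ?_, fun x => ?_⟩
  · have hl : Function.leftLim G 0 = G 0 := hc.continuousWithinAt.leftLim_eq
    rw [StieltjesFunction.measure_Icc, hl]
    change ENNReal.ofReal (g 1 - g 0) = 1
    simp [h0, h1]
  · exact congrFun (congrArg (fun H : StieltjesFunction ℝ => (H : ℝ → ℝ))
      (cdf_measure_stieltjesFunction G hbot htop)) x

/-- Any null proportion `r ≤ π₀*` with `r ∈ (0,1)` is compatible with the mixture `F`: put the
`p`-values of the true nulls in the upper part of `F`. -/
lemma exists_same_mixture (hθ : θ ∈ superUnifParams) {r : ℝ} (hr : r ∈ Set.Ioo (0 : ℝ) 1)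
    (hrs : r ≤ θ.pi0Star) : ∃ θ' ∈ superUnifParams, θ'.pi0 = r ∧ θ'.F = θ.F := by
  have hr0 := hr.1
  have hr1 : 0 < 1 - r := sub_pos.2 hr.2
  have hF1 : ∀ x, 1 ≤ x → θ.F x = 1 := fun x hx =>
    le_antisymm (θ.F_le_one x) (θ.F_one ▸ θ.monotone_F hx)
  -- The nulls receive the top mass `r` of `F`: `r F₀ = max 0 (F - (1 - r))` and `(1 - r) F₁ = min
  -- (1 - r) F`, which sum to `F`.
  obtain ⟨ν0, hp0, hs0, hc0⟩ := exists_law_of_cdf (g := fun x => max 0 (1 - (1 - θ.F x) / r))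
    (fun x y h => by have := θ.monotone_F h; dsimp only; gcongr)
    (by have := θ.continuous_F; fun_prop)
    (fun x hx => by
      simp only [F_of_nonpos hθ hx]
      refine max_eq_left ?_
      rw [sub_nonpos, le_div_iff₀ hr0]
      linarith)
    (fun x hx => by simp [hF1 x hx])
  obtain ⟨ν1, hp1, hs1, hc1⟩ := exists_law_of_cdf (g := fun x => min 1 (θ.F x / (1 - r)))
    (fun x y h => by have := θ.monotone_F h; dsimp only; gcongr)
    (by have := θ.continuous_F; fun_prop)
    (fun x hx => by simp [F_of_nonpos hθ hx])
    (fun x hx => by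
      simp only [hF1 x hx]
      refine min_eq_left ?_
      rw [le_div_iff₀ hr1]
      linarith)
  have hF : ∀ x, r * cdf ν0 x + (1 - r) * cdf ν1 x = θ.F x := fun x => by
    rw [hc0, hc1, mul_max_of_nonneg _ _ hr0.le, mul_min_of_nonneg _ _ hr1.le]
    have e0 : r * (1 - (1 - θ.F x) / r) = r - 1 + θ.F x := by field_simp; ring
    have e1 : (1 - r) * (θ.F x / (1 - r)) = θ.F x := by field_simp
    rw [e0, e1]
    rcases le_total (θ.F x) (1 - r) with h | h
    · rw [max_eq_left (by linarith), min_eq_right (by linarith)]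
      ring
    · rw [max_eq_right (by linarith), min_eq_left (by linarith)]
      ring
  refine ⟨⟨r, ⟨hr0.le, hr.2.le⟩, ν0, ν1, hp0, hp1, hs0, hs1, ?_, ?_⟩, ⟨hr0, fun x hx => ?_, ?_⟩,
    rfl, funext hF⟩
  · rw [funext hc0]
    have := θ.continuous_F
    fun_prop
  · rw [funext hc1]
    have := θ.continuous_F
    fun_prop
  · rw [hc0]
    refine max_le hx.1 ?_
    -- Super-uniformity of this `F₀` amounts to `r (1 - x) ≤ 1 - F x`, which is where `r ≤ π₀*`
    -- enters.
    have h1 : r * (1 - x) ≤ 1 - θ.F x :=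
      (mul_le_mul_of_nonneg_right hrs (sub_nonneg.2 hx.2)).trans (pi0Star_mul_le hθ hx)
    have h2 : 1 - x ≤ (1 - θ.F x) / r := by
      rw [le_div_iff₀ hr0]
      linarith
    linarith
  · obtain ⟨-, -, f, hfL, hf0, hf⟩ := hθ
    exact ⟨f, hfL, hf0, fun x hx => (hF x).trans (hf x hx)⟩

end Params

/-! ### Conservative concentrating estimators concentrate above `π₀*` -/

lemma critVal_self_eq_one {a v : ℝ} {m : ℕ} (hm : 0 < m) (hv : 0 ≤ v) (hva : v ≤ a) :
    critVal a 1 m v m = 1 := by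
  unfold critVal
  have hm' : (0 : ℝ) < m := by exact_mod_cast hm
  split_ifs with h h'
  · omega
  · rfl
  · refine min_eq_left ?_
    have : 0 < v := lt_of_le_of_ne hv (Ne.symm h)
    rw [le_div_iff₀ (by positivity)]
    nlinarith

lemma abhCount_eq_of_le {a v : ℝ} {m : ℕ} (hm : 0 < m) (hv : 0 ≤ v) (hva : v ≤ a)
    {p : Fin m → ℝ} (hp : ∀ i, p i ≤ 1) : abhCount a 1 v p = m := by
  classical
  refine le_antisymm (Nat.findGreatest_le _) (Nat.le_findGreatest le_rfl ?_)
  rw [critVal_self_eq_one hm hv hva, orderStat_le_iff p hm le_rfl]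
  simp [hp]

lemma card_filter_le_cast {m : ℕ} (P : Fin m → Prop) [DecidablePred P] :
    ((Finset.univ.filter P).card : ℝ) ≤ m := by
  exact_mod_cast (Finset.card_filter_le _ _).trans (by simp)

open Classical in
lemma integrable_null_proportion (θ : TwoGroup) (m : ℕ) :
    Integrable (fun ω : Fin m → Bool × ℝ =>
      ((Finset.univ.filter fun i : Fin m => (ω i).1 = false).card : ℝ) / m) (θ.law m) := by
  refine Integrable.of_bound (C := 1) (Measurable.aestronglyMeasurable ?_)
    (Eventually.of_forall fun ω => ?_)
  · have h : Measurable fun ω : Fin m → Bool × ℝ =>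
        (Finset.univ.filter fun i : Fin m => (ω i).1 = false).card :=
      measurable_card_filter fun i => (measurable_pi_apply i).fst (measurableSet_singleton false)
    exact (measurable_from_top.comp h).div_const _
  · rw [Real.norm_of_nonneg (by positivity)]
    exact div_le_one_of_le₀ (card_filter_le_cast _) (by positivity)

open Classical in
lemma integrable_fdp (θ : TwoGroup) {m : ℕ} {π : (Fin m → ℝ) → ℝ} (hπ : Measurable π) (a : ℝ) :
    Integrable (fun ω : Fin m → Bool × ℝ => ((Finset.univ.filter fun i : Fin m =>
        (ω i).1 = false ∧ (ω i).2 ≤ abhThreshold a 1 (π (pvals ω)) (pvals ω)).card : ℝ)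
      / ((max (abhCount a 1 (π (pvals ω)) (pvals ω)) 1 : ℕ) : ℝ)) (θ.law m) := by
  refine Integrable.of_bound (C := m) (Measurable.aestronglyMeasurable ?_)
    (Eventually.of_forall fun ω => ?_)
  · have h : Measurable fun ω : Fin m → Bool × ℝ => max (abhCount a 1 (π (pvals ω)) (pvals ω)) 1 :=
      ((measurable_abhCount hπ a 1).comp measurable_pvals).max measurable_const
    exact (measurable_rejections hπ a 1 false).div (measurable_from_top.comp h)
  · rw [Real.norm_of_nonneg (by positivity)]
    refine (div_le_self (by positivity) ?_).trans (card_filter_le_cast _)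
    exact_mod_cast le_max_right _ _

open Classical in
lemma fdp_eq_null_proportion {m : ℕ} (hm : 0 < m) {a v : ℝ} (hv : 0 ≤ v) (hva : v ≤ a)
    {ω : Fin m → Bool × ℝ} (hω : ∀ i, pvals ω i ≤ 1) :
    ((Finset.univ.filter fun i : Fin m =>
        (ω i).1 = false ∧ (ω i).2 ≤ abhThreshold a 1 v (pvals ω)).card : ℝ)
      / ((max (abhCount a 1 v (pvals ω)) 1 : ℕ) : ℝ)
      = ((Finset.univ.filter fun i : Fin m => (ω i).1 = false).card : ℝ) / m := by
  have hω' : ∀ i, (ω i).2 ≤ 1 := hω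
  rw [abhThreshold, abhCount_eq_of_le hm hv hva hω, critVal_self_eq_one hm hv hva,
    max_eq_left (Nat.one_le_iff_ne_zero.2 hm.ne')]
  simp [hω']

/-- On `S` everything is rejected almost surely, so the false discovery proportion is the proportion
of nulls, of mean `π₀`. Off `S`, that proportion minus `1` is nonpositive. -/
lemma le_FDR {θ : TwoGroup} {m : ℕ} (hm : 0 < m) {a : ℝ} {π : (Fin m → ℝ) → ℝ}
    (hπ : Measurable π) (hπ0 : ∀ p, 0 ≤ π p) {S : Set (Fin m → ℝ)} (hS : MeasurableSet S)
    (hSa : ∀ p ∈ S, π p ≤ a) :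
    θ.pi0 - (1 - (θ.law m).real {ω | pvals ω ∈ S}) ≤ FDR θ m a 1 π := by
  have hSm : MeasurableSet {ω : Fin m → Bool × ℝ | pvals ω ∈ S} := measurable_pvals hS
  have hVi := integrable_null_proportion θ m
  have hI : Integrable ({ω : Fin m → Bool × ℝ | pvals ω ∈ S}ᶜ.indicator fun _ => (1 : ℝ))
      (θ.law m) := (integrable_const _).indicator hSm.compl
  have h1 := integral_sub hVi hI
  rw [θ.integral_null_proportion hm, integral_indicator_const _ hSm.compl,
    probReal_compl_eq_one_sub hSm, smul_eq_mul, mul_one] at h1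
  rw [← h1, FDR]
  refine integral_mono_ae (hVi.sub hI) (integrable_fdp θ hπ a) ?_
  filter_upwards [θ.ae_pvals_le_one m] with ω hω
  by_cases hωS : pvals ω ∈ S
  · rw [fdp_eq_null_proportion hm (hπ0 _) (hSa _ hωS) hω, Set.indicator_of_notMem (by simpa), sub_zero]
  · rw [Set.indicator_of_mem (by exact hωS)]
    refine (sub_nonpos.2 ?_).trans (by positivity)
    exact div_le_one_of_le₀ (card_filter_le_cast _) (by positivity)

theorem pi0Star_le_of_concentrating {π : (m : ℕ) → (Fin m → ℝ) → ℝ} (hπ : IsPi0Estimator π)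
    {piBar : TwoGroup → ℝ} {η δ : ℕ → TwoGroup → ℝ}
    (hFDR : FDRConservative superUnifParams 1 π)
    (hconc : Concentrating superUnifParams π piBar η δ) {θ : TwoGroup}
    (hθ : θ ∈ superUnifParams) : θ.pi0Star ≤ piBar θ := by
  by_contra! hlt
  obtain ⟨hpos, hη, hδ, hP⟩ := hconc
  -- With `piBar < a < r < π₀*`, the gap `a - piBar` absorbs `η` and the gap `r - a` absorbs `δ`.
  -- Concentration is used at `θ`, conservativeness at `θ'`.
  obtain ⟨r, hr1, hr2⟩ := exists_between hlt
  obtain ⟨a, ha1, ha2⟩ := exists_between hr1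
  have ha0 : 0 < a := (hpos θ hθ).trans ha1
  have hr : r ∈ Set.Ioo (0 : ℝ) 1 := ⟨by linarith, hr2.trans_le (pi0Star_le_one hθ)⟩
  obtain ⟨θ', hθ', hpi, hF⟩ := exists_same_mixture hθ hr hr2.le
  obtain ⟨m, hm2, hm, hηm, hδm⟩ := ((eventually_ge_atTop 2).and (hP.and
    (((hη θ hθ).eventually_lt_const (sub_pos.2 ha1)).and
      ((hδ θ hθ).eventually_lt_const (sub_pos.2 ha2))))).exists
  have hS : MeasurableSet {p : Fin m → ℝ | |π m p - piBar θ| ≤ η m θ} :=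
    measurableSet_le ((hπ m).1.sub_const _).abs measurable_const
  have h1 := le_FDR (θ := θ') (by omega : 0 < m) (hπ m).1 (hπ m).2 hS (a := a) fun p hp => by
    have hp' : |π m p - piBar θ| ≤ η m θ := hp
    linarith [(abs_le.1 hp').2]
  rw [TwoGroup.real_law_pvals_congr hF hS, hpi] at h1
  have h2 := hFDR a ⟨ha0, by linarith [hr.2]⟩ m hm2 θ' hθ'
  have h3 := hm θ hθ
  simp only [Set.mem_ofPred_eq] at h1
  linarith

/-! ### The Minimum-Storey estimator -/

lemma upperSemicontinuous_card_ge (m : ℕ) (x : ℝ) : UpperSemicontinuous fun p : Fin m → ℝ =>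
    ((Finset.univ.filter fun i : Fin m => x ≤ p i).card : ℝ) := by
  have h : (fun p : Fin m → ℝ => ((Finset.univ.filter fun i : Fin m => x ≤ p i).card : ℝ))
      = fun p => ∑ i : Fin m, {p : Fin m → ℝ | x ≤ p i}.indicator (fun _ => (1 : ℝ)) p := by
    funext p
    rw [Finset.card_filter]
    push_cast
    exact Finset.sum_congr rfl fun i _ => by simp [Set.indicator_apply]
  rw [h]
  exact upperSemicontinuous_sum fun i _ => IsClosed.upperSemicontinuous_indicator
    (isClosed_le continuous_const (continuous_apply i)) zero_le_one

lemma ratio_nonneg {m : ℕ} {e : ℝ} (he : 0 ≤ e) (N : ℕ) (x : Set.Icc (0 : ℝ) (1 - e)) :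
    0 ≤ ((max 1 N : ℕ) : ℝ) / (m * (1 - (x : ℝ))) :=
  div_nonneg (by positivity) (mul_nonneg (by positivity) (by linarith [x.2.2]))

/-- The infimum is uncountable, but each count of `pᵢ ≥ x` is upper semicontinuous (indicators of
closed sets), and infima preserve this. -/
lemma measurable_msEstimator (m : ℕ) {e : ℝ} (he : 0 ≤ e) (b : ℝ) :
    Measurable (msEstimator m e b) := by
  unfold msEstimator
  simp_rw [sInf_image']
  refine measurable_const.max (measurable_const.mul (UpperSemicontinuous.measurable ?_))
  refine upperSemicontinuous_ciInf (fun p => ⟨0, ?_⟩) fun x => ?_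
  · rintro _ ⟨x, rfl⟩
    exact ratio_nonneg he _ x
  · have h := (upperSemicontinuous_const (z := (1 : ℝ))).sup (upperSemicontinuous_card_ge m x)
    have hmono : Monotone fun y : ℝ => y / (m * (1 - (x : ℝ))) := fun y z hyz =>
      div_le_div_of_nonneg_right hyz (mul_nonneg (by positivity) (by linarith [x.2.2]))
    convert (continuous_id.div_const (m * (1 - (x : ℝ)))).comp_upperSemicontinuous h hmono using 2
    push_cast
    rfl

lemma msEstimator_le {m : ℕ} {e b : ℝ} (he : 0 ≤ e) {x : ℝ} (hx : x ∈ Set.Icc (0 : ℝ) (1 - e))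
    (p : Fin m → ℝ) :
    msEstimator m e b p ≤ max b (bigC m e b *
      (((max 1 (Finset.univ.filter fun i : Fin m => x ≤ p i).card : ℕ) : ℝ) / (m * (1 - x)))) := by
  unfold msEstimator
  refine max_le_max_left _ (mul_le_mul_of_nonneg_left ?_ (bigC_nonneg m e b))
  refine (csInf_le ⟨0, ?_⟩ (Set.mem_image_of_mem _ hx)).trans (le_of_eq ?_)
  · rintro _ ⟨y, hy, rfl⟩
    exact ratio_nonneg he _ ⟨y, hy⟩
  · rfl

lemma law_real_card_ge_le (θ : TwoGroup) {m : ℕ} {x t u : ℝ} (ht0 : 0 ≤ t) (ht1 : t ≤ 1) :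
    (θ.law m).real {ω | m * (1 - θ.F x) + u
        ≤ ((Finset.univ.filter fun i : Fin m => x ≤ pvals ω i).card : ℝ)}
      ≤ Real.exp (t ^ 2 * m - t * u) := by
  have hA : MeasurableSet {z : Bool × ℝ | x ≤ z.2} :=
    measurableSet_le measurable_const measurable_snd
  have hle : θ.pairLaw.real {z : Bool × ℝ | x ≤ z.2} ≤ 1 - θ.F x := by
    refine le_trans (le_of_eq ?_) (θ.pvalLaw_real_Ici_le x)
    rw [TwoGroup.pvalLaw, map_measureReal_apply measurable_snd measurableSet_Ici]
    rfl
  refine le_trans (measureReal_mono fun ω hω => ?_)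
    (real_card_ge_le (fun _ : Fin m => θ.pairLaw) hA (u := u) ht0 ht1)
  have hω' : m * (1 - θ.F x) + u
        ≤ ((Finset.univ.filter fun i : Fin m => x ≤ pvals ω i).card : ℝ) := hω
  change (∑ _i : Fin m, θ.pairLaw.real {z : Bool × ℝ | x ≤ z.2}) + u ≤
    ((Finset.univ.filter fun i : Fin m => x ≤ pvals ω i).card : ℝ)
  refine le_trans ?_ hω'
  simp only [Finset.sum_const, Finset.card_univ, Fintype.card_fin, nsmul_eq_mul]
  gcongr

/-! ### Explicit rates when `m e⁴ = 1` -/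

section Rates

variable {m : ℕ} {e : ℝ}

lemma bigC_le_of_rate (he0 : 0 < e) (hme : m * e ^ 4 = 1) (hL : 324 ≤ Real.log m)
    (hLe : Real.log m ^ 2 * e ≤ 1) : bigC m e (162 / Real.log m) ≤ 1 + 9 * e := by
  set L := Real.log m with hLdef
  have hL0 : 0 < L := by linarith
  have hm0 : (0 : ℝ) < m := by
    by_contra h
    nlinarith [pow_pos he0 4]
  have he8 : e ≤ 1 / 8 := by nlinarith [mul_pos he0 hL0]
  have hLe1 : L * e ≤ 1 := by nlinarith [mul_pos he0 hL0]
  have hm : (m : ℝ) = 1 / e ^ 4 := by field_simp; linarith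
  have hbm : 162 / L * m = 162 / (L * e) / e ^ 3 := by
    rw [hm]
    field_simp
  have h162 : 162 * L ≤ 162 / (L * e) := by
    rw [le_div_iff₀ (by positivity)]
    nlinarith
  have he3 : e ^ 3 ≤ 1 := pow_le_one₀ he0.le (by linarith)
  refine bigC_le he0 he8 ?_ ?_ ?_
  · rw [hm]
    have : e ^ 2 * (1 / e ^ 4) = 1 / e ^ 2 := by field_simp
    rw [this, le_div_iff₀ (by positivity), one_mul]
    exact pow_le_one₀ he0.le (by linarith)
  · have : e * (162 / L * m) = 162 / (L * e) / e ^ 2 := by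
      rw [hbm]
      field_simp
    rw [this, le_div_iff₀ (by positivity), one_mul]
    exact (pow_le_one₀ he0.le (by linarith)).trans (by linarith)
  -- The exponent is about `81 / (L e) ≥ 81 L`; already `3 L` suffices, since `m² · m⁻³ = e⁴ ≤ e`.
  · have h3 : 3 * L ≤ e ^ 2 * ((162 / L * m - 1) * (e / 2)) := by
      have : e ^ 2 * ((162 / L * m - 1) * (e / 2)) = (162 / (L * e) - e ^ 3) / 2 := by
        rw [hbm]
        field_simp
      rw [this]
      linarith
    have hexp : Real.exp (-(e ^ 2 * ((162 / L * m - 1) * (e / 2)))) ≤ (1 / m) ^ 3 := by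
      refine (Real.exp_le_exp.2 (neg_le_neg h3)).trans (le_of_eq ?_)
      have : Real.exp L = m := Real.exp_log hm0
      rw [Real.exp_neg, mul_comm, Real.exp_mul, this]
      norm_num
    calc (m : ℝ) * (m * Real.exp (-(e ^ 2 * ((162 / L * m - 1) * (e / 2)))))
        ≤ m * (m * (1 / m) ^ 3) := by gcongr
      _ = e * e ^ 3 := by
        rw [hm]
        field_simp
      _ ≤ e := mul_le_of_le_one_right he0.le he3

/-- Error budget with `R = √(log m)`: bias `K e`, normalization at most `9 (K + 3) e`, fluctuation
`2 R e`. For large `m` the first two together are at most `R e`. -/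
lemma msEstimator_le_of_card_lt {θ : TwoGroup} {K x : ℝ} (hp1 : θ.pi0Star ≤ 1) (hK0 : 0 ≤ K)
    (hx : x ∈ Set.Icc (0 : ℝ) (1 - e)) (hxK : 1 - θ.F x ≤ (θ.pi0Star + K * e) * (1 - x))
    (he0 : 0 < e) (hme : m * e ^ 4 = 1) (hL : 324 ≤ Real.log m)
    (hLe : Real.log m ^ 2 * e ≤ 1) (hb : 162 / Real.log m ≤ θ.pi0Star)
    (hLK : K + 9 * (K + 3) ≤ Real.sqrt (Real.log m)) {p : Fin m → ℝ}
    (hN : ((Finset.univ.filter fun i : Fin m => x ≤ p i).card : ℝ)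
      < m * (1 - θ.F x) + 2 * Real.sqrt (Real.log m) / e ^ 2) :
    msEstimator m e (162 / Real.log m) p ≤ θ.pi0Star + 4 * (Real.sqrt (Real.log m) * e) := by
  have hC := bigC_le_of_rate he0 hme hL hLe
  set L := Real.log m with hLdef
  set R := Real.sqrt L with hRdef
  have hL0 : 0 < L := by linarith
  have hR1 : 1 ≤ R := Real.one_le_sqrt.2 (by linarith)
  have hRL : R ≤ L ^ 2 := by
    have : R * R = L := Real.mul_self_sqrt hL0.le
    nlinarith
  have hRe : R * e ≤ 1 := (mul_le_mul_of_nonneg_right hRL he0.le).trans hLe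
  have he1 : e ≤ 1 := by nlinarith
  have hm0 : (0 : ℝ) < m := by
    by_contra h
    nlinarith [pow_pos he0 4]
  have hm : (m : ℝ) = 1 / e ^ 4 := by field_simp; linarith
  refine (msEstimator_le he0.le hx p).trans (max_le (by nlinarith) ?_)
  have hx1 : e ≤ 1 - x := by linarith [hx.2]
  have hM : ((max 1 (Finset.univ.filter fun i : Fin m => x ≤ p i).card : ℕ) : ℝ)
      ≤ m * ((θ.pi0Star + K * e) * (1 - x)) + 2 * R / e ^ 2 := by
    have h0 : 0 ≤ m * (1 - θ.F x) := mul_nonneg hm0.le (sub_nonneg.2 (θ.F_le_one x))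
    have h1 : m * (1 - θ.F x) ≤ m * ((θ.pi0Star + K * e) * (1 - x)) := by gcongr
    have h2 : 1 ≤ 2 * R / e ^ 2 := by
      rw [le_div_iff₀ (by positivity)]
      nlinarith
    push_cast
    exact max_le (by linarith) (by linarith)
  have hratio : ((max 1 (Finset.univ.filter fun i : Fin m => x ≤ p i).card : ℕ) : ℝ)
      / (m * (1 - x)) ≤ θ.pi0Star + K * e + 2 * (R * e) := by
    rw [div_le_iff₀ (mul_pos hm0 (by linarith))]
    refine hM.trans ?_
    -- The denominator is at least `m e = e⁻³`, because `x ≤ 1 - e`.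
    have h3 : 2 * R / e ^ 2 ≤ 2 * (R * e) * (m * (1 - x)) := by
      calc 2 * R / e ^ 2 = 2 * (R * e) * (m * e) := by
            rw [hm]
            field_simp
        _ ≤ _ := by gcongr
    nlinarith
  have hr0 : 0 ≤ ((max 1 (Finset.univ.filter fun i : Fin m => x ≤ p i).card : ℕ) : ℝ)
      / (m * (1 - x)) := ratio_nonneg he0.le _ ⟨x, hx⟩
  have hKe : K * e ≤ K := mul_le_of_le_one_right hK0 he1
  calc bigC m e (162 / L) * _ ≤ (1 + 9 * e) * (θ.pi0Star + K * e + 2 * (R * e)) :=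
        mul_le_mul hC hratio hr0 (by positivity)
    _ = θ.pi0Star + (K * e + 9 * e * (θ.pi0Star + K * e + 2 * (R * e))) + 2 * (R * e) := by ring
    _ ≤ θ.pi0Star + (K * e + 9 * e * (K + 3)) + 2 * (R * e) := by
        have : θ.pi0Star + K * e + 2 * (R * e) ≤ K + 3 := by linarith
        gcongr
    _ = θ.pi0Star + (K + 9 * (K + 3)) * e + 2 * (R * e) := by ring
    _ ≤ θ.pi0Star + R * e + 2 * (R * e) := by gcongr
    _ ≤ _ := by nlinarith [mul_nonneg (by linarith : (0:ℝ) ≤ R) he0.le]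

lemma law_real_card_ge_le_inv (θ : TwoGroup) (x : ℝ) (he0 : 0 < e) (hme : m * e ^ 4 = 1)
    (hL : 324 ≤ Real.log m) (hLe : Real.log m ^ 2 * e ≤ 1) :
    (θ.law m).real {ω | m * (1 - θ.F x) + 2 * Real.sqrt (Real.log m) / e ^ 2
        ≤ ((Finset.univ.filter fun i : Fin m => x ≤ pvals ω i).card : ℝ)} ≤ 1 / m := by
  set L := Real.log m with hLdef
  have hL0 : 0 < L := by linarith
  have hR2 : Real.sqrt L ^ 2 = L := Real.sq_sqrt hL0.le
  have hR1 : 1 ≤ Real.sqrt L := Real.one_le_sqrt.2 (by linarith)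
  have hm0 : (0 : ℝ) < m := by
    by_contra h
    nlinarith [pow_pos he0 4]
  have ht1 : Real.sqrt L * e ^ 2 ≤ 1 := by
    have he1 : e ≤ 1 := by nlinarith [mul_pos he0 hL0]
    have : Real.sqrt L ≤ L ^ 2 := by nlinarith
    nlinarith [mul_le_mul_of_nonneg_right this he0.le, mul_pos he0 he0]
  -- This `t` minimizes `t² m - t u` for `u = 2 R / e²`; the minimum is `-log m`.
  refine (law_real_card_ge_le θ (t := Real.sqrt L * e ^ 2) (by positivity) ht1).trans
    (le_of_eq ?_)
  have : (Real.sqrt L * e ^ 2) ^ 2 * m - Real.sqrt L * e ^ 2 * (2 * Real.sqrt L / e ^ 2) = -L := by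
    have h1 : (Real.sqrt L * e ^ 2) ^ 2 * m = Real.sqrt L ^ 2 * (m * e ^ 4) := by ring
    have h2 : Real.sqrt L * e ^ 2 * (2 * Real.sqrt L / e ^ 2) = 2 * Real.sqrt L ^ 2 := by
      field_simp
    rw [h1, h2, hme, hR2]
    ring
  rw [this, Real.exp_neg, Real.exp_log hm0, one_div]

end Rates

/-! ### Comparison of powers -/

open Classical in
lemma rejections_card_le {α α' : ℝ} (hα : 0 ≤ α) {m : ℕ} {v w : ℝ} (hv : 0 < v) (hw : 0 < w)
    (h : α' * w ≤ α * v) (ω : Fin m → Bool × ℝ) :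
    (Finset.univ.filter fun i : Fin m =>
        (ω i).1 = true ∧ (ω i).2 ≤ abhThreshold α' 1 v (pvals ω)).card
      ≤ (Finset.univ.filter fun i : Fin m =>
        (ω i).1 = true ∧ (ω i).2 ≤ abhThreshold α 1 w (pvals ω)).card :=
  Finset.card_le_card <| Finset.monotone_filter_right _ fun _ _ hi =>
    ⟨hi.1, hi.2.trans (abhThreshold_mono hα hw.le _ (critVal_le_critVal m hw hv h))⟩

/-- On `S \ T` the rejection sets are nested; elsewhere a rejected proportion is at most `1`, which
the indicators of `T` and `Sᶜ` pay for. -/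
lemma power_sub_power_le {θ : TwoGroup} {m : ℕ} {α α' : ℝ} (hα : 0 ≤ α)
    {π π' : (Fin m → ℝ) → ℝ} (hπ : Measurable π) {S T : Set (Fin m → Bool × ℝ)}
    (hS : MeasurableSet S) (hT : MeasurableSet T)
    (hST : ∀ ω ∈ S, ω ∉ T → 0 < π' (pvals ω) ∧ 0 < π (pvals ω) ∧
      α' * π (pvals ω) ≤ α * π' (pvals ω)) :
    Power θ m α' 1 π' - Power θ m α 1 π ≤ (θ.law m).real T + (θ.law m).real Sᶜ := by
  classical
  have hf : Integrable (fun ω : Fin m → Bool × ℝ => ((Finset.univ.filter fun i : Fin m =>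
        (ω i).1 = true ∧ (ω i).2 ≤ abhThreshold α 1 (π (pvals ω)) (pvals ω)).card : ℝ) / (m : ℝ))
      (θ.law m) := by
    refine Integrable.of_bound (C := 1)
      ((measurable_rejections hπ α 1 true).div_const _).aestronglyMeasurable
      (Eventually.of_forall fun ω => ?_)
    rw [Real.norm_of_nonneg (by positivity)]
    exact div_le_one_of_le₀ (card_filter_le_cast _) (by positivity)
  have hTi : Integrable (T.indicator fun _ => (1 : ℝ)) (θ.law m) :=
    (integrable_const _).indicator hT
  have hSi : Integrable (Sᶜ.indicator fun _ => (1 : ℝ)) (θ.law m) :=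
    (integrable_const _).indicator hS.compl
  have hTS : Integrable (fun ω => T.indicator (fun _ => (1 : ℝ)) ω
      + Sᶜ.indicator (fun _ => (1 : ℝ)) ω) (θ.law m) := hTi.add hSi
  have key : Power θ m α' 1 π' ≤ ∫ ω, (((Finset.univ.filter fun i : Fin m =>
        (ω i).1 = true ∧ (ω i).2 ≤ abhThreshold α 1 (π (pvals ω)) (pvals ω)).card : ℝ) / (m : ℝ)
        + (T.indicator (fun _ => (1 : ℝ)) ω + Sᶜ.indicator (fun _ => (1 : ℝ)) ω)) ∂(θ.law m) := by
    refine integral_mono_of_nonneg (Eventually.of_forall fun ω => ?_) (hf.add hTS)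
      (Eventually.of_forall fun ω => ?_)
    · dsimp only [Pi.zero_apply]
      positivity
    have hT0 : 0 ≤ T.indicator (fun _ => (1 : ℝ)) ω := Set.indicator_nonneg (by simp) _
    have hS0 : 0 ≤ Sᶜ.indicator (fun _ => (1 : ℝ)) ω := Set.indicator_nonneg (by simp) _
    have h1 : ((Finset.univ.filter fun i : Fin m => (ω i).1 = true ∧
        (ω i).2 ≤ abhThreshold α' 1 (π' (pvals ω)) (pvals ω)).card : ℝ) / (m : ℝ) ≤ 1 :=
      div_le_one_of_le₀ (card_filter_le_cast _) (by positivity)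
    have h0 : 0 ≤ ((Finset.univ.filter fun i : Fin m => (ω i).1 = true ∧
        (ω i).2 ≤ abhThreshold α 1 (π (pvals ω)) (pvals ω)).card : ℝ) / (m : ℝ) := by positivity
    by_cases hωT : ω ∈ T
    · have : T.indicator (fun _ => (1 : ℝ)) ω = 1 := Set.indicator_of_mem hωT _
      dsimp only
      linarith
    by_cases hωS : ω ∈ S
    · obtain ⟨hv, hw, h⟩ := hST ω hωS hωT
      have h2 := rejections_card_le hα hv hw h ω
      refine le_trans ?_ (le_add_of_nonneg_right (add_nonneg hT0 hS0))
      dsimp only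
      gcongr
    · have : Sᶜ.indicator (fun _ => (1 : ℝ)) ω = 1 := Set.indicator_of_mem (by exact hωS) _
      dsimp only
      linarith
  rw [integral_add hf hTS, integral_add hTi hSi, integral_indicator_const _ hT,
    integral_indicator_const _ hS.compl, smul_eq_mul, smul_eq_mul, mul_one, mul_one] at key
  rw [sub_le_iff_le_add']
  exact key

/-- The corrections work because `(1 - x)(1 + x) ≤ 1` and `p (p - 2η) ≤ (p - η)²`; `η < p/2` keeps
the second factor nonnegative. -/
lemma level_mul_le {α p x η v w : ℝ} (hα : 0 ≤ α) (hp : 0 < p) (hx1 : x ≤ 1)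
    (hη : η < p / 2) (hv : p - η ≤ v) (hw : w ≤ p * (1 + x)) :
    α * (1 - x) * (1 - η / (p - η)) * w ≤ α * v := by
  have hd : 0 < p - η := by linarith
  have hq : 0 ≤ 1 - η / (p - η) := by
    rw [sub_nonneg, div_le_one hd]
    linarith
  have h1 : (1 - x) * w ≤ p := by
    have := mul_le_mul_of_nonneg_left hw (sub_nonneg.2 hx1)
    nlinarith [mul_nonneg hp.le (mul_self_nonneg x)]
  have h2 : (1 - η / (p - η)) * p ≤ p - η := by
    have : (1 - η / (p - η)) * p = (p - 2 * η) * p / (p - η) := by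
      field_simp
      ring
    rw [this, div_le_iff₀ hd]
    nlinarith [mul_self_nonneg η]
  calc α * (1 - x) * (1 - η / (p - η)) * w = α * ((1 - η / (p - η)) * ((1 - x) * w)) := by ring
    _ ≤ α * ((1 - η / (p - η)) * p) := by gcongr
    _ ≤ α * v := by
        gcongr
        linarith

lemma tendsto_log_sq_mul_rpow :
    Tendsto (fun m : ℕ => Real.log m ^ 2 * (m : ℝ) ^ (-(1 / 4) : ℝ)) atTop (𝓝 0) := by
  have h := (isLittleO_log_rpow_rpow_atTop (s := 1 / 4) 2 (by norm_num)).tendsto_div_nhds_zero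
  have h' := h.comp tendsto_natCast_atTop_atTop
  refine h'.congr fun m => ?_
  simp only [Function.comp]
  rw [Real.rpow_neg (Nat.cast_nonneg m), ← div_eq_mul_inv, Real.rpow_two]

end MultTest

end

theorem corollary5p4
    (π : (m : ℕ) → (Fin m → ℝ) → ℝ) (hπ : MultTest.IsPi0Estimator π)
    (piBar : MultTest.TwoGroup → ℝ) (η δ : ℕ → MultTest.TwoGroup → ℝ)
    (hFDR : MultTest.FDRConservative MultTest.superUnifParams 1 π)
    (hconc : MultTest.Concentrating MultTest.superUnifParams π piBar η δ) :
    ∀ θ ∈ MultTest.superUnifParams, ∀ᶠ m : ℕ in atTop, ∀ α ∈ Set.Ioc (0 : ℝ) 1,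
      MultTest.Power θ m
          (α * (1 - (4 / θ.pi0Star) * Real.sqrt (Real.log m) * (m : ℝ) ^ (-(1 / 4) : ℝ))
            * (1 - η m θ / (θ.pi0Star - η m θ))) 1 (π m)
        - MultTest.Power θ m α 1
            (MultTest.msEstimator m ((m : ℝ) ^ (-(1 / 4) : ℝ)) (min 0.5 (162 / Real.log m)))
        ≤ 1 / m + δ m θ := by
  intro θ hθ
  have hbar := MultTest.pi0Star_le_of_concentrating hπ hFDR hconc hθ
  have hp := MultTest.pi0Star_pos hθ
  have hp1 := MultTest.pi0Star_le_one hθ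
  obtain ⟨K, hK0, hK⟩ := MultTest.exists_ratio_le hθ
  obtain ⟨-, hη, -, hP⟩ := hconc
  have hlog : Tendsto (fun m : ℕ => Real.log m) atTop atTop :=
    Real.tendsto_log_atTop.comp tendsto_natCast_atTop_atTop
  have hsqrt : Tendsto (fun m : ℕ => Real.sqrt (Real.log m)) atTop atTop :=
    Real.tendsto_sqrt_atTop.comp hlog
  -- `324` makes `162 / log m` the active term of the minimum, `162 / π₀*` puts this floor below
  -- `π₀*`, and `π₀*/4` keeps the first correction factor nonnegative.
  filter_upwards [hP, (hη θ hθ).eventually_lt_const (half_pos hp), eventually_gt_atTop 0,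
    hlog.eventually_ge_atTop 324, hlog.eventually_ge_atTop (162 / θ.pi0Star),
    hsqrt.eventually_ge_atTop (K + 9 * (K + 3)),
    MultTest.tendsto_log_sq_mul_rpow.eventually_le_const (show (0 : ℝ) < θ.pi0Star / 4 by positivity)]
    with m hPm hηm hm hL hLp hLK hLe α hα
  have hm0 : (0 : ℝ) < m := by exact_mod_cast hm
  have hb : min 0.5 (162 / Real.log m) = 162 / Real.log m := by
    refine min_eq_right ?_
    rw [div_le_iff₀ (by linarith)]
    linarith
  have hb' : 162 / Real.log m ≤ θ.pi0Star := by
    rw [div_le_iff₀ (by linarith)]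
    rw [div_le_iff₀ hp] at hLp
    linarith
  rw [hb]
  have he0 : 0 < (m : ℝ) ^ (-(1 / 4) : ℝ) := by positivity
  have hme : m * ((m : ℝ) ^ (-(1 / 4) : ℝ)) ^ 4 = 1 := by
    rw [← Real.rpow_natCast, ← Real.rpow_mul hm0.le]
    norm_num [Real.rpow_neg_one]
    exact mul_inv_cancel₀ hm0.ne'
  set e : ℝ := (m : ℝ) ^ (-(1 / 4) : ℝ)
  have hLe1 : Real.log m ^ 2 * e ≤ 1 := by linarith
  have hR1 : 1 ≤ Real.sqrt (Real.log m) := Real.one_le_sqrt.2 (by linarith)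
  have hRL : Real.sqrt (Real.log m) ≤ Real.log m ^ 2 := by
    have : Real.sqrt (Real.log m) ^ 2 = Real.log m := Real.sq_sqrt (by linarith)
    nlinarith
  have hRe : Real.sqrt (Real.log m) * e ≤ θ.pi0Star / 4 :=
    (mul_le_mul_of_nonneg_right hRL he0.le).trans hLe
  have hRe0 : 0 ≤ Real.sqrt (Real.log m) * e := by positivity
  have he1 : e ≤ 1 := by nlinarith
  obtain ⟨x, hx, hxK⟩ := hK e ⟨he0, he1⟩
  have hxe : 4 / θ.pi0Star * Real.sqrt (Real.log m) * e
      = 4 * (Real.sqrt (Real.log m) * e) / θ.pi0Star := by ring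
  have hS : MeasurableSet {ω : Fin m → Bool × ℝ | |π m (MultTest.pvals ω) - piBar θ| ≤ η m θ} :=
    measurableSet_le (((hπ m).1.comp MultTest.measurable_pvals).sub_const _).abs measurable_const
  have hT : MeasurableSet {ω : Fin m → Bool × ℝ |
      m * (1 - θ.F x) + 2 * Real.sqrt (Real.log m) / e ^ 2
        ≤ ((Finset.univ.filter fun i : Fin m => x ≤ MultTest.pvals ω i).card : ℝ)} := by
    have h : Measurable fun ω : Fin m → Bool × ℝ =>
        (Finset.univ.filter fun i : Fin m => x ≤ MultTest.pvals ω i).card :=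
      MultTest.measurable_card_filter fun i =>
        measurableSet_le measurable_const (measurable_pi_apply i).snd
    exact measurableSet_le measurable_const (measurable_from_top.comp h)
  refine (MultTest.power_sub_power_le hα.1.le (MultTest.measurable_msEstimator m he0.le _) hS hT
    fun ω hωS hωT => ?_).trans (add_le_add
      (MultTest.law_real_card_ge_le_inv θ x he0 hme hL hLe1) ?_)
  -- Only the lower side of the concentration matters: `piBar` may lie far above `π₀*`.
  · have hv : θ.pi0Star - η m θ ≤ π m (MultTest.pvals ω) := by
      have h : |π m (MultTest.pvals ω) - piBar θ| ≤ η m θ := hωS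
      linarith [(abs_le.1 h).1]
    have hw := MultTest.msEstimator_le_of_card_lt hp1 hK0 hx hxK he0 hme hL hLe1 hb' hLK
      (not_le.1 hωT)
    refine ⟨by linarith, lt_of_lt_of_le (div_pos (by norm_num) (by linarith)) (le_max_left _ _), ?_⟩
    refine MultTest.level_mul_le hα.1.le hp ?_ hηm hv (hw.trans (le_of_eq ?_))
    · rw [hxe, div_le_one hp]
      linarith
    · rw [hxe]
      field_simp
  · rw [probReal_compl_eq_one_sub hS]
    linarith [hPm θ hθ]
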